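/- Let $X$ be a separable real Banach space that is (isometrically) the dual of a Banach space $X_*$, let $Y$ be a separable real Hilbert space, and let $A:X\to Y$ be a bounded linear operator that is the adjoint of a bounded linear operator $A_*:Y\to X_*$. Let $d\in\mathbb N$, let $S\subset\mathbb R^d$ be non-empty and compact, and let $J:X\times S\to[0,+\infty]$ be Borel measurable such that (i) for every $s\in S$, $J(\cdot,s)$ is proper, convex and satisfies $J(\lambda v,s)=\lambda J(v,s)$ for all $\lambda\ge0$, $v\in X$ (with $0\cdot\infty=0$); (ii) $J$ is sequentially lower semicontinuous on $X\times S$, where $X$ carries the weak* topology; (iii) there is $C>0$ with $\|v\|_X\le C\,J(v,s)$ for all $v\in X$, $s\in S$. Let $f\in Y$ and $\alpha>0$. Let $\mathcal M_+(S)$ be the set of finite positive Borel measures on $S$ and $\mathcal M(S;X)$ the set of countably additive $X$-valued Borel measures $\mu$ on $S$ with finite variation measure $|\mu|$. For $\sigma\in\mathcal M_+(S)$ and $u\in L^1((S,\sigma);X)$ (Bochner space), let $u\sigma\in\mathcal M(S;X)$ be given by $(u\sigma)(E)=\int_E u\,d\sigma$. For $v\in X$ and $\sigma\in\mathcal M_+(S)$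 let $$R(v,\sigma)=\inf\Big\{\int_S J(u(s),s)\,d\sigma(s)\ :\ u\in L^1((S,\sigma);X),\ \int_S u\,d\sigma=v\Big\}\in[0,+\infty].$$ For every $\mu\in\mathcal M(S;X)$ there is a unique $\frac{\mu}{|\mu|}\in L^1((S,|\mu|);X)$ with $\mu=\frac{\mu}{|\mu|}\,|\mu|$. Consider the problems $$\text{(P)}\quad \inf_{v\in X,\ \sigma\in\mathcal M_+(S)}\ \tfrac12\|Av-f\|_Y^2+\alpha R(v,\sigma),$$ $$\text{(P')}\quad \inf_{\sigma\in\mathcal M_+(S),\ u\in L^1((S,\sigma);X)}\ \tfrac12\Big\|A\int_S u\,d\sigma-f\Big\|_Y^2+\alpha\int_S J(u(s),s)\,d\sigma(s),$$ $$\text{(L)}\quad \inf_{\mu\in\mathcal M(S;X)}\ \tfrac12\|A\mu(S)-f\|_Y^2+\alpha\int_S J\Big(\tfrac{\mu}{|\mu|}(s),s\Big)\,d|\mu|(s).$$ Then (P') and (L) have the same infimum. If $(\bar u,\bar\sigma)$ is a minimizer of (P'), then $\bar\mu=\bar u\bar\sigma$ is a minimizer of (L). Conversely, if $\bar\mu$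 is a minimizer of (L), then $\big(\frac{\bar\mu}{|\bar\mu|},|\bar\mu|\big)$ is a minimizer of (P') and $(\bar\mu(S),|\bar\mu|)$ is a minimizer of (P). -/

import Mathlib

open MeasureTheory Filter Topology
open scoped ENNReal NNReal

noncomputable section

namespace InfConv

/-! ## Measures with values in a Banach space -/

/-- `RadonVM S X` is the space `𝓜(S; X)` of countably additive `X`-valued Borel measures on `S`
with finite total variation. -/
def RadonVM (S : Type*) [MeasurableSpace S] (X : Type*) [NormedAddCommGroup X] : Type _ :=
  {μ : VectorMeasure S X // IsFiniteMeasure μ.variation}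

variable {S : Type*} [MeasurableSpace S]
variable {X : Type*} [NormedAddCommGroup X]

/-- The variation measure `|μ| ∈ 𝓜₊(S)`. -/
def RadonVM.tv (μ : RadonVM S X) : FiniteMeasure S := ⟨μ.1.variation, μ.2⟩

variable [NormedSpace ℝ X]

/-- `u ∈ L¹((S, |μ|); X)` is a density of `μ` with respect to `|μ|`. -/
def RadonVM.IsDensity (μ : RadonVM S X) (u : Lp X 1 (μ.tv : Measure S)) : Prop :=
  ∀ E : Set S, MeasurableSet E → μ.1 E = ∫ s in E, u s ∂(μ.tv : Measure S)

open Classical in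
/-- The density `μ / |μ| ∈ L¹((S, |μ|); X)` (with the value `0` if no density exists, which never
happens when `X` has the Radon–Nikodým property). -/
def RadonVM.polar (μ : RadonVM S X) : Lp X 1 (μ.tv : Measure S) :=
  if h : ∃ u, μ.IsDensity u then h.choose else 0

theorem isFiniteMeasure_variation_withDensityᵥ [CompleteSpace X] (σ : FiniteMeasure S)
    (u : Lp X 1 (σ : Measure S)) :
    IsFiniteMeasure ((σ : Measure S).withDensityᵥ u).variation := by
  have hu : Integrable u (σ : Measure S) := L1.integrable_coeFn u
  rw [Measure.variation_withDensityᵥ hu]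
  exact isFiniteMeasure_withDensity hu.2.ne

/-- The measure `u σ ∈ 𝓜(S; X)`, that is `E ↦ ∫_E u dσ`. -/
def prodMeasure [CompleteSpace X] (σ : FiniteMeasure S) (u : Lp X 1 (σ : Measure S)) :
    RadonVM S X :=
  ⟨(σ : Measure S).withDensityᵥ u, isFiniteMeasure_variation_withDensityᵥ σ u⟩

theorem prodMeasure_apply [CompleteSpace X] (σ : FiniteMeasure S) (u : Lp X 1 (σ : Measure S))
    {E : Set S} (hE : MeasurableSet E) :
    (prodMeasure σ u).1 E = ∫ s in E, u s ∂(σ : Measure S) :=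
  withDensityᵥ_apply (L1.integrable_coeFn u) hE

/-! ## The integrands -/

/-- The standing assumptions on `J : X × S → [0, ∞]`, where the Banach space `X` is the dual of `P`
through the isometric isomorphism `e`, and the weak* topology of `X` is the one induced by `P`. -/
structure IsAdmissible {P : Type*} [NormedAddCommGroup P] [NormedSpace ℝ P]
    [TopologicalSpace S] [MeasurableSpace X]
    (e : X ≃ₗᵢ[ℝ] StrongDual ℝ P) (J : X → S → ℝ≥0∞) : Prop where
  measurable : Measurable (fun p : X × S => J p.1 p.2)
  proper : ∀ s, ∃ v, J v s ≠ ∞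
  convex : ∀ s, ∀ v w : X, ∀ a b : ℝ≥0, a + b = 1 →
    J ((a : ℝ) • v + (b : ℝ) • w) s ≤ a * J v s + b * J w s
  homogeneous : ∀ s, ∀ v : X, ∀ r : ℝ≥0, J ((r : ℝ) • v) s = r * J v s
  lsc : ∀ (v : ℕ → X) (s : ℕ → S) (v₀ : X) (s₀ : S),
    Tendsto (fun n => StrongDual.toWeakDual (e (v n))) atTop (𝓝 (StrongDual.toWeakDual (e v₀))) →
    Tendsto s atTop (𝓝 s₀) →
    J v₀ s₀ ≤ liminf (fun n => J (v n) (s n)) atTop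
  coercive : ∃ C : ℝ≥0, 0 < C ∧ ∀ v s, ‖v‖ₑ ≤ C * J v s

/-! ## The functionals and the three variational problems -/

/-- `F_σ(u) = ∫_S J(u(s), s) dσ(s)` for `u ∈ L¹((S, σ); X)`. -/
def F (J : X → S → ℝ≥0∞) (σ : FiniteMeasure S) (u : Lp X 1 (σ : Measure S)) : ℝ≥0∞ :=
  ∫⁻ s, J (u s) s ∂(σ : Measure S)

/-- The infinite infimal convolution
`R(v, σ) = inf {F_σ(u) : u ∈ L¹((S, σ); X), ∫_S u dσ = v}`. -/
def R (J : X → S → ℝ≥0∞) (v : X) (σ : FiniteMeasure S) : ℝ≥0∞ :=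
  ⨅ (u : Lp X 1 (σ : Measure S)) (_ : ∫ s, u s ∂(σ : Measure S) = v), F J σ u

/-- The lifted regularizer `F̂(μ) = ∫_S J((μ/|μ|)(s), s) d|μ|(s)`. -/
def Fhat (J : X → S → ℝ≥0∞) (μ : RadonVM S X) : ℝ≥0∞ :=
  ∫⁻ s, J (μ.polar s) s ∂(μ.tv : Measure S)

variable {Y : Type*} [NormedAddCommGroup Y] [InnerProductSpace ℝ Y]

/-- The objective `½ ‖A v - f‖² + α R(v, σ)` on pairs `(v, σ) ∈ X × 𝓜₊(S)`. -/
def objR (J : X → S → ℝ≥0∞) (A : X →L[ℝ] Y) (f : Y) (α : ℝ)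
    (p : X × FiniteMeasure S) : ℝ≥0∞ :=
  ENNReal.ofReal (1 / 2 * ‖A p.1 - f‖ ^ 2) + ENNReal.ofReal α * R J p.1 p.2

/-- The objective `½ ‖A ∫_S u dσ - f‖² + α ∫_S J(u(s), s) dσ(s)` on pairs `(u, σ)` with
`σ ∈ 𝓜₊(S)` and `u ∈ L¹((S, σ); X)`. -/
def objU (J : X → S → ℝ≥0∞) (A : X →L[ℝ] Y) (f : Y) (α : ℝ)
    (p : (σ : FiniteMeasure S) × Lp X 1 (σ : Measure S)) : ℝ≥0∞ :=
  ENNReal.ofReal (1 / 2 * ‖A (∫ s, p.2 s ∂(p.1 : Measure S)) - f‖ ^ 2)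
    + ENNReal.ofReal α * F J p.1 p.2

/-- The lifted objective `½ ‖A μ(S) - f‖² + α F̂(μ)` on `𝓜(S; X)`. -/
def objLift (J : X → S → ℝ≥0∞) (A : X →L[ℝ] Y) (f : Y) (α : ℝ) (μ : RadonVM S X) : ℝ≥0∞ :=
  ENNReal.ofReal (1 / 2 * ‖A (μ.1 Set.univ) - f‖ ^ 2) + ENNReal.ofReal α * Fhat J μ

/-- `x` is a global minimizer of `G`. -/
def IsMinimizer {T : Type*} (G : T → ℝ≥0∞) (x : T) : Prop := IsMinOn G Set.univ x

end InfConv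

end

/-! The maps `μ ↦ (|μ|, μ/|μ|)` and `(σ, u) ↦ uσ` between (L) and (P') preserve the objective
(`objU_polar`, `objLift_prodMeasure`), so infima and minimizers transfer. For the second map, `|uσ|
= ‖u‖σ` and `u = ‖u‖ w` σ-a.e. with `w` the polar density of `uσ`; positive homogeneity of `J`
absorbs the factor `‖u‖`. Problem (P) is (P') with `u` minimized out first. The analytic core is the
existence of `μ/|μ|`, the Radon–Nikodým property of a separable dual (`exists_density_variation`).
The predual is separable, hence has a countable dense subgroup. Scalar densities of `μ` tested
against its elements are, off one null set, additive and bounded by the norm, so at each point they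
extend to a functional, the value of the density. -/

namespace InfConv

/-! ## Separability of preduals and extension of functionals from dense subgroups -/

/-- A real normed space with separable dual is separable. -/
theorem separableSpace_of_separableSpace_dual (P : Type*) [NormedAddCommGroup P] [NormedSpace ℝ P]
    [TopologicalSpace.SeparableSpace (StrongDual ℝ P)] : TopologicalSpace.SeparableSpace P := by
  let φ : ℕ → StrongDual ℝ P := TopologicalSpace.denseSeq _
  have hex : ∀ n, ∃ p : P, ‖p‖ ≤ 1 ∧ ‖φ n‖ / 2 ≤ ‖φ n p‖ := fun n => by
    rcases eq_or_ne (φ n) 0 with h | h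
    · exact ⟨0, by simp, by simp [h]⟩
    · obtain ⟨p, hp, hlt⟩ := (φ n).exists_lt_apply_of_lt_opNorm
        (show ‖φ n‖ / 2 < ‖φ n‖ by linarith [norm_pos_iff.2 h])
      exact ⟨p, hp.le, hlt.le⟩
  choose p hp hφp using hex
  have hsep : TopologicalSpace.IsSeparable
      ((Submodule.span ℝ (Set.range p)).topologicalClosure : Set P) :=
    ((Set.countable_range p).isSeparable.span (R := ℝ)).closure
  suffices h : (Submodule.span ℝ (Set.range p)).topologicalClosure = ⊤ by
    rw [h] at hsep
    exact TopologicalSpace.isSeparable_univ_iff.1 hsep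
  by_contra hne
  obtain ⟨q, hq⟩ : ∃ q, q ∉ (Submodule.span ℝ (Set.range p)).topologicalClosure := by
    by_contra! h
    exact hne (Submodule.eq_top_iff'.2 h)
  -- A functional bounded above on a subspace vanishes there, so `ψ ≠ 0` kills every `p n`.
  obtain ⟨ψ, u, hlt, hu⟩ := geometric_hahn_banach_closed_point
    (Submodule.convex _) (Submodule.isClosed_topologicalClosure _) hq
  have hu0 : 0 < u := by simpa using hlt 0 (Submodule.zero_mem _)
  have hzero : ∀ n, ψ (p n) = 0 := fun n => by
    by_contra h0
    have hmem : (u / ψ (p n)) • p n ∈ (Submodule.span ℝ (Set.range p)).topologicalClosure :=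
      Submodule.smul_mem _ _ (Submodule.le_topologicalClosure _
        (Submodule.subset_span (Set.mem_range_self n)))
    have := hlt _ hmem
    rw [map_smul, smul_eq_mul, div_mul_cancel₀ _ h0] at this
    exact lt_irrefl _ this
  have hψ : 0 < ‖ψ‖ := norm_pos_iff.2 fun h => by
    rw [h] at hu
    exact lt_asymm hu0 hu
  -- With `δ = ‖ψ - φ n‖`, the choice of `p n` gives `‖φ n‖ ≤ 2δ`, so `‖ψ‖ ≤ 3δ`; any `δ < ‖ψ‖ / 3`
  -- is contradictory.
  obtain ⟨n, hn⟩ := (TopologicalSpace.denseRange_denseSeq (StrongDual ℝ P)).exists_dist_lt ψ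
    (show 0 < ‖ψ‖ / 4 by linarith)
  rw [dist_eq_norm] at hn
  have h1 : ‖φ n (p n)‖ ≤ ‖ψ - φ n‖ := by
    have := (ψ - φ n).le_of_opNorm_le_of_le le_rfl (hp n)
    simpa [hzero n] using this
  have h2 : ‖ψ‖ ≤ ‖ψ - φ n‖ + ‖φ n‖ := by simpa using norm_add_le (ψ - φ n) (φ n)
  have h3 := hφp n
  change ‖ψ - φ n‖ < _ at hn
  linarith

/-- An additive function on a dense subgroup that is bounded by the norm extends to a continuous
linear functional of norm at most one. -/
theorem exists_dual_extension_of_dense {P : Type*} [NormedAddCommGroup P] [NormedSpace ℝ P]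
    (D : AddSubgroup P) (hD : Dense (D : Set P)) (g : D → ℝ) (hadd : ∀ a b, g (a + b) = g a + g b)
    (hg : ∀ a, |g a| ≤ ‖(a : P)‖) :
    ∃ φ : StrongDual ℝ P, ‖φ‖ ≤ 1 ∧ ∀ a : D, φ a = g a := by
  let g' : D →+ ℝ := AddMonoidHom.mk' g hadd
  let G : P → ℝ := Function.extend (↑) g 0
  have hG : ∀ a : D, G a = g a := Subtype.val_injective.extend_apply g 0
  have hlip : LipschitzOnWith 1 G D := LipschitzOnWith.of_dist_le_mul fun a ha b hb => by
    have h := hg (⟨a, ha⟩ - ⟨b, hb⟩)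
    have hs : g (⟨a, ha⟩ - ⟨b, hb⟩) = g ⟨a, ha⟩ - g ⟨b, hb⟩ := map_sub g' _ _
    rw [hs] at h
    rw [hG ⟨a, ha⟩, hG ⟨b, hb⟩, Real.dist_eq, NNReal.coe_one, one_mul, dist_eq_norm]
    exact h
  -- This extension is only Lipschitz. Additivity returns by density, and continuous additive maps
  -- are real linear, which is why a subgroup suffices.
  obtain ⟨Φ, hΦ, hΦG⟩ := hlip.extend_real
  have hΦD : ∀ a : D, Φ a = g a := fun a => (hΦG a.2).symm.trans (hG a)
  have hΦadd : ∀ a b, Φ (a + b) = Φ a + Φ b := fun a b => by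
    have := hΦ.continuous
    refine (hD.prod hD).induction (P := fun q : P × P => Φ (q.1 + q.2) = Φ q.1 + Φ q.2) ?_
      (isClosed_eq (by fun_prop) (by fun_prop)) (a, b)
    rintro ⟨x, y⟩ ⟨hx, hy⟩
    exact (hΦD (⟨x, hx⟩ + ⟨y, hy⟩)).trans
      ((hadd _ _).trans (by rw [← hΦD, ← hΦD]))
  let φ : StrongDual ℝ P := (AddMonoidHom.mk' Φ hΦadd).toRealLinearMap hΦ.continuous
  refine ⟨φ, φ.opNorm_le_bound zero_le_one fun x => ?_, hΦD⟩
  have h0 : Φ 0 = 0 := map_zero (AddMonoidHom.mk' Φ hΦadd)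
  have := hΦ.dist_le_mul x 0
  rw [h0] at this
  change |Φ x| ≤ _
  simpa using this

/-- A separable normed space has a countable dense subgroup. -/
theorem exists_countable_dense_addSubgroup (P : Type*) [NormedAddCommGroup P]
    [TopologicalSpace.SeparableSpace P] :
    ∃ D : AddSubgroup P, Countable D ∧ Dense (D : Set P) := by
  let L : (ℕ →₀ ℤ) →+ P :=
    (Finsupp.linearCombination ℤ (TopologicalSpace.denseSeq P)).toAddMonoidHom
  refine ⟨L.range, (Set.countable_range L).to_subtype,
    (TopologicalSpace.denseRange_denseSeq P).mono ?_⟩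
  rintro _ ⟨n, rfl⟩
  exact ⟨Finsupp.single n 1, by simp [L]⟩

/-! ## The Radon–Nikodým property of separable duals -/

section RadonNikodym

variable {P : Type*} [NormedAddCommGroup P] [NormedSpace ℝ P]
  {X : Type*} [NormedAddCommGroup X] [NormedSpace ℝ X] [CompleteSpace X]
  {S : Type*} [MeasurableSpace S]

/-- A real valued vector measure dominated by a multiple of a finite measure has a density, which
is bounded almost everywhere by the same constant. -/
theorem exists_density_of_abs_le (σ : Measure S) [IsFiniteMeasure σ] (ν : SignedMeasure S)
    (c : ℝ) (hν : ∀ E, MeasurableSet E → |ν E| ≤ c * σ.real E) :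
    ∃ g : S → ℝ, Measurable g ∧ Integrable g σ ∧
      (∀ E, MeasurableSet E → ∫ s in E, g s ∂σ = ν E) ∧ ∀ᵐ s ∂σ, |g s| ≤ c := by
  have hac : ν ≪ᵥ σ.toENNRealVectorMeasure := VectorMeasure.AbsolutelyContinuous.mk
    fun E hE h0 => by
      rw [Measure.toENNRealVectorMeasure_apply_measurable hE] at h0
      have := hν E hE
      rw [measureReal_def, h0, ENNReal.toReal_zero, mul_zero] at this
      exact abs_nonpos_iff.1 this
  have hint : Integrable (ν.rnDeriv σ) σ := SignedMeasure.integrable_rnDeriv ν σ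
  have heq : ∀ E, MeasurableSet E → ∫ s in E, ν.rnDeriv σ s ∂σ = ν E := fun E hE => by
    rw [← withDensityᵥ_apply hint hE, SignedMeasure.withDensityᵥ_rnDeriv_eq ν σ hac]
  refine ⟨ν.rnDeriv σ, SignedMeasure.measurable_rnDeriv ν σ, hint, heq, ?_⟩
  -- Comparing integrals over all measurable sets turns the bound on `ν` into a pointwise a.e.
  -- bound.
  have hle : ν.rnDeriv σ ≤ᵐ[σ] fun _ => c :=
    ae_le_of_forall_setIntegral_le hint (integrable_const c) fun E hE _ => by
      rw [heq E hE, setIntegral_const, smul_eq_mul, mul_comm]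
      exact (abs_le.1 (hν E hE)).2
  have hge : (fun _ => -c) ≤ᵐ[σ] ν.rnDeriv σ :=
    ae_le_of_forall_setIntegral_le (integrable_const _) hint fun E hE _ => by
      rw [heq E hE, setIntegral_const, smul_eq_mul, mul_neg, mul_comm]
      exact (abs_le.1 (hν E hE)).1
  filter_upwards [hle, hge] with s h1 h2 using abs_le.2 ⟨h2, h1⟩

/-- A measure of bounded variation with values in a separable dual space has a bounded density with
respect to its variation. -/
theorem exists_density_variation [TopologicalSpace.SeparableSpace X] [MeasurableSpace X]
    [BorelSpace X] (e : X ≃ₗᵢ[ℝ] StrongDual ℝ P) (μ : VectorMeasure S X)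
    [IsFiniteMeasure μ.variation] :
    ∃ u : S → X, Integrable u μ.variation ∧
      ∀ E, MeasurableSet E → μ E = ∫ s in E, u s ∂μ.variation := by
  have : TopologicalSpace.SeparableSpace (StrongDual ℝ P) :=
    e.surjective.denseRange.separableSpace e.continuous
  have := separableSpace_of_separableSpace_dual P
  obtain ⟨D, hDc, hD⟩ := exists_countable_dense_addSubgroup P
  set σ := μ.variation
  let ev : P → X →L[ℝ] ℝ := fun p =>
    (ContinuousLinearMap.apply ℝ ℝ p).comp (e.toContinuousLinearEquiv : X →L[ℝ] StrongDual ℝ P)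
  have hev : ∀ p x, ev p x = e x p := fun _ _ => rfl
  have hsep : ∀ x y, (∀ a : D, ev a x = ev a y) → x = y := fun x y h =>
    e.injective <| DFunLike.coe_injective <|
      (e x).continuous.ext_on hD (e y).continuous fun p hp => h ⟨p, hp⟩
  let ν : D → SignedMeasure S := fun a => μ.mapRange (ev a : X →+ ℝ) (ev a).continuous
  have hν : ∀ a E, ν a E = ev a (μ E) := fun a E => rfl
  have hbound : ∀ (a : D) (E), MeasurableSet E → |ν a E| ≤ ‖(a : P)‖ * σ.real E := fun a E _ => by
    rw [hν, hev, mul_comm]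
    calc |e (μ E) a| ≤ ‖e (μ E)‖ * ‖(a : P)‖ := (e (μ E)).le_opNorm a
      _ ≤ σ.real E * ‖(a : P)‖ := by
        rw [e.norm_map]
        gcongr
        exact VectorMeasure.norm_measure_le_variation
  choose g hgm hgi hgE hgb using fun a => exists_density_of_abs_le σ (ν a) ‖(a : P)‖ (hbound a)
  have hgadd : ∀ a b : D, ∀ᵐ s ∂σ, g (a + b) s = g a s + g b s := fun a b =>
    (hgi (a + b)).ae_eq_of_forall_setIntegral_eq _ _ ((hgi a).add (hgi b)) fun E hE _ => by
      rw [integral_add (hgi a).integrableOn (hgi b).integrableOn, hgE _ E hE, hgE _ E hE,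
        hgE _ E hE]
      simp only [hν, hev, AddSubgroup.coe_add, map_add]
  -- Countability of `D` lets all the a.e. relations hold simultaneously off a single null set.
  let good : Set S :=
    {s | (∀ a b : D, g (a + b) s = g a s + g b s) ∧ ∀ a : D, |g a s| ≤ ‖(a : P)‖}
  have hgood_meas : MeasurableSet good := by
    refine MeasurableSet.inter (s₁ := {s | ∀ a b : D, g (a + b) s = g a s + g b s})
      (s₂ := {s | ∀ a : D, |g a s| ≤ ‖(a : P)‖}) ?_ ?_
    · simp only [Set.ofPred_forall]
      exact .iInter fun a => .iInter fun b =>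
        measurableSet_eq_fun (hgm _) ((hgm a).add (hgm b))
    · simp only [Set.ofPred_forall]
      exact .iInter fun a => measurableSet_le (hgm a).abs measurable_const
  have hgood_ae : ∀ᵐ s ∂σ, s ∈ good :=
    (ae_all_iff.2 fun a => ae_all_iff.2 fun b => hgadd a b).and (ae_all_iff.2 hgb)
  have hex : ∀ s, ∃ x : X, ‖x‖ ≤ 1 ∧ ∀ a : D, ev a x = good.indicator (g a) s := fun s => by
    by_cases hs : s ∈ good
    · obtain ⟨φ, hφ, hφg⟩ := exists_dual_extension_of_dense D hD (fun a => g a s) hs.1 hs.2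
      exact ⟨e.symm φ, by simpa using hφ, fun a => by simp [hev, hs, hφg]⟩
    · exact ⟨0, by simp, fun a => by simp [hs]⟩
  choose u hu1 hug using hex
  -- Lusin–Souslin: a continuous injection of the Polish space `X` into a countable product of lines
  -- is a Borel embedding, so coordinatewise measurability of `u` yields norm-Borel measurability.
  have hemb : MeasurableEmbedding fun (x : X) (a : D) => ev a x :=
    Continuous.measurableEmbedding (by fun_prop) fun x y h => hsep x y fun a => congrFun h a
  have hum : Measurable u := hemb.measurable_comp_iff.1 <| measurable_pi_iff.2 fun a => by
    simp only [Function.comp_def, hug]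
    exact (hgm a).indicator hgood_meas
  have hui : Integrable u σ :=
    Integrable.of_bound hum.aestronglyMeasurable 1 (Eventually.of_forall hu1)
  refine ⟨u, hui, fun E hE => hsep _ _ fun a => ?_⟩
  rw [← ContinuousLinearMap.integral_comp_comm _ hui.integrableOn, ← hν, ← hgE a E hE]
  refine integral_congr_ae (ae_restrict_of_ae ?_)
  filter_upwards [hgood_ae] with s hs
  simp [hug, hs]

end RadonNikodym

/-! ## Polar decomposition and the lifted functional -/

section Lift

variable {S : Type*} [MeasurableSpace S] {X : Type*} [NormedAddCommGroup X] [NormedSpace ℝ X]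

/-- Multiplication by `α` passes through the infimum because `α` is finite and nonzero; nonzero
matters when no `u` has integral `v`, where both sides are `∞`. -/
theorem objR_eq_iInf_objU {Y : Type*} [NormedAddCommGroup Y] [InnerProductSpace ℝ Y]
    (A : X →L[ℝ] Y) (f : Y) (J : X → S → ℝ≥0∞) {α : ℝ} (hα : 0 < α) (v : X) (σ : FiniteMeasure S) :
    objR J A f α (v, σ) =
      ⨅ (u : Lp X 1 (σ : Measure S)) (_ : ∫ s, u s ∂(σ : Measure S) = v),
        objU J A f α ⟨σ, u⟩ := by
  simp only [objR, R, ENNReal.mul_iInf_of_ne (ENNReal.ofReal_pos.2 hα).ne' ENNReal.ofReal_ne_top,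
    ENNReal.add_iInf]
  refine iInf_congr fun u => iInf_congr fun hu => ?_
  rw [objU, hu]

variable [CompleteSpace X]

theorem RadonVM.IsDensity.unique {μ : RadonVM S X} {u v : Lp X 1 (μ.tv : Measure S)}
    (hu : μ.IsDensity u) (hv : μ.IsDensity v) : u = v :=
  Lp.ext <| (L1.integrable_coeFn u).ae_eq_of_forall_setIntegral_eq _ _ (L1.integrable_coeFn v)
    fun E hE _ => (hu E hE).symm.trans (hv E hE)

theorem tv_prodMeasure (σ : FiniteMeasure S) (u : Lp X 1 (σ : Measure S)) :
    ((prodMeasure σ u).tv : Measure S) = (σ : Measure S).withDensity fun s => ‖u s‖₊ :=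
  Measure.variation_withDensityᵥ (L1.integrable_coeFn u)

variable {P : Type*} [NormedAddCommGroup P] [NormedSpace ℝ P]
  [TopologicalSpace.SeparableSpace X] [MeasurableSpace X] [BorelSpace X]

theorem RadonVM.exists_isDensity (e : X ≃ₗᵢ[ℝ] StrongDual ℝ P) (μ : RadonVM S X) :
    ∃ u, μ.IsDensity u := by
  have := μ.2
  obtain ⟨u, hu, huE⟩ := exists_density_variation e μ.1
  refine ⟨hu.toL1 u, fun E hE => (huE E hE).trans ?_⟩
  exact integral_congr_ae (ae_restrict_of_ae hu.coeFn_toL1.symm)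

theorem RadonVM.isDensity_polar (e : X ≃ₗᵢ[ℝ] StrongDual ℝ P) (μ : RadonVM S X) :
    μ.IsDensity μ.polar := by
  have h := μ.exists_isDensity e
  rw [RadonVM.polar, dif_pos h]
  exact h.choose_spec

/-- A density `u` with respect to `σ` is the polar density of `u σ` times `‖u‖`. -/
theorem norm_smul_polar_prodMeasure (e : X ≃ₗᵢ[ℝ] StrongDual ℝ P) (σ : FiniteMeasure S)
    (u : Lp X 1 (σ : Measure S)) :
    (fun s => ‖u s‖₊ • (prodMeasure σ u).polar s) =ᵐ[(σ : Measure S)] u := by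
  set w := (prodMeasure σ u).polar
  have hm : Measurable fun s => ‖u s‖₊ := (Lp.stronglyMeasurable u).nnnorm.measurable
  have hw : Integrable w ((σ : Measure S).withDensity fun s => ‖u s‖₊) := by
    rw [← tv_prodMeasure]
    exact L1.integrable_coeFn w
  refine ((integrable_withDensity_iff_integrable_smul hm).1 hw).ae_eq_of_forall_setIntegral_eq _ _
    (L1.integrable_coeFn u) fun E hE _ => ?_
  rw [← prodMeasure_apply σ u hE, (prodMeasure σ u).isDensity_polar e E hE]
  -- The type of the polar density depends on the measure, so the measures are exchanged for an
  -- arbitrary function `g`.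
  have htv (g : S → X) : ∫ s in E, g s ∂((prodMeasure σ u).tv : Measure S) =
      ∫ s in E, g s ∂(σ : Measure S).withDensity fun s => ‖u s‖₊ := by rw [tv_prodMeasure]
  rw [htv]
  exact (setIntegral_withDensity_eq_setIntegral_smul hm _ hE).symm

variable {Y : Type*} [NormedAddCommGroup Y] [InnerProductSpace ℝ Y]
  (A : X →L[ℝ] Y) (f : Y) (α : ℝ)

theorem objU_polar (e : X ≃ₗᵢ[ℝ] StrongDual ℝ P) (J : X → S → ℝ≥0∞) (μ : RadonVM S X) :
    objU J A f α ⟨μ.tv, μ.polar⟩ = objLift J A f α μ := by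
  rw [objLift, objU, μ.isDensity_polar e _ .univ, setIntegral_univ]
  rfl

variable [TopologicalSpace S] {e : X ≃ₗᵢ[ℝ] StrongDual ℝ P} {J : X → S → ℝ≥0∞}

/-- The lifted regularizer of `u σ` equals `F_σ(u)`. -/
theorem Fhat_prodMeasure (hJ : IsAdmissible e J) (σ : FiniteMeasure S)
    (u : Lp X 1 (σ : Measure S)) : Fhat J (prodMeasure σ u) = F J σ u := by
  have hw : Measurable (prodMeasure σ u).polar := (Lp.stronglyMeasurable _).measurable
  have hm : Measurable fun s => (‖u s‖₊ : ℝ≥0∞) :=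
    (Lp.stronglyMeasurable u).nnnorm.measurable.coe_nnreal_ennreal
  have htv (g : S → ℝ≥0∞) : ∫⁻ s, g s ∂((prodMeasure σ u).tv : Measure S) =
      ∫⁻ s, g s ∂(σ : Measure S).withDensity fun s => ‖u s‖₊ := by rw [tv_prodMeasure]
  have hJw : Measurable fun s => J ((prodMeasure σ u).polar s) s :=
    hJ.measurable.comp (hw.prodMk measurable_id)
  rw [Fhat, F, htv, lintegral_withDensity_eq_lintegral_mul _ hm hJw]
  refine lintegral_congr_ae ?_
  -- Where `u` vanishes the polar density is arbitrary, but homogeneity with factor `0` makes both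
  -- sides `0`.
  filter_upwards [norm_smul_polar_prodMeasure e σ u] with s hs
  conv_rhs => rw [← hs]
  exact (hJ.homogeneous s _ _).symm

theorem objLift_prodMeasure (hJ : IsAdmissible e J) (σ : FiniteMeasure S)
    (u : Lp X 1 (σ : Measure S)) :
    objLift J A f α (prodMeasure σ u) = objU J A f α ⟨σ, u⟩ := by
  rw [objLift, objU, Fhat_prodMeasure hJ, prodMeasure_apply σ u .univ, setIntegral_univ]

end Lift

end InfConv

/-! ### Transfer of infima and minimizers -/

theorem mainTheorem6
    {P : Type*} [NormedAddCommGroup P] [NormedSpace ℝ P] [CompleteSpace P]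
    {X : Type*} [NormedAddCommGroup X] [NormedSpace ℝ X] [CompleteSpace X]
    [TopologicalSpace.SeparableSpace X] [MeasurableSpace X] [BorelSpace X]
    (e : X ≃ₗᵢ[ℝ] StrongDual ℝ P)
    {Y : Type*} [NormedAddCommGroup Y] [InnerProductSpace ℝ Y] [CompleteSpace Y]
    [TopologicalSpace.SeparableSpace Y]
    (A : X →L[ℝ] Y)
    (hA : ∃ B : Y →L[ℝ] P, ∀ (v : X) (y : Y), inner ℝ (A v) y = e v (B y))
    {d : ℕ} (S : Set (EuclideanSpace ℝ (Fin d))) (hSne : S.Nonempty) (hS : IsCompact S)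
    (J : X → S → ℝ≥0∞) (hJ : InfConv.IsAdmissible e J)
    (f : Y) (α : ℝ) (hα : 0 < α) :
    -- the density `μ / |μ|` exists and is unique in `L¹((S, |μ|); X)`
    (∀ μ : InfConv.RadonVM S X, ∃! u, μ.IsDensity u) ∧
    -- equal infima
    (⨅ p, InfConv.objU J A f α p) = (⨅ μ, InfConv.objLift J A f α μ) ∧
    -- from the `(u, σ)` problem to the lifted problem
    (∀ (σ : FiniteMeasure S) (u : Lp X 1 (σ : Measure S)),
      InfConv.IsMinimizer (InfConv.objU J A f α) ⟨σ, u⟩ →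
      InfConv.IsMinimizer (InfConv.objLift J A f α) (InfConv.prodMeasure σ u)) ∧
    -- from the lifted problem to the `(u, σ)` problem and to the `(v, σ)` problem
    (∀ μ : InfConv.RadonVM S X,
      InfConv.IsMinimizer (InfConv.objLift J A f α) μ →
      InfConv.IsMinimizer (InfConv.objU J A f α) ⟨μ.tv, μ.polar⟩ ∧
      InfConv.IsMinimizer (InfConv.objR J A f α) (μ.1 Set.univ, μ.tv)) := by
  have hlift := InfConv.objLift_prodMeasure A f α hJ
  have hpolar := InfConv.objU_polar (S := S) A f α e J
  refine ⟨fun μ => ?_, le_antisymm ?_ ?_, fun σ u hmin => ?_, fun μ hmin => ?_⟩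
  · obtain ⟨u, hu⟩ := μ.exists_isDensity e
    exact ⟨u, hu, fun v hv => hv.unique hu⟩
  · exact le_iInf fun μ => (iInf_le _ _).trans_eq (hpolar μ)
  · exact le_iInf fun p => (iInf_le _ _).trans_eq (hlift p.1 p.2)
  · refine isMinOn_univ_iff.2 fun μ => ?_
    rw [hlift, ← hpolar]
    exact isMinOn_univ_iff.1 hmin _
  · have hle : ∀ p, InfConv.objU J A f α ⟨μ.tv, μ.polar⟩ ≤ InfConv.objU J A f α p := fun p => by
      rw [hpolar, ← hlift]
      exact isMinOn_univ_iff.1 hmin _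
    refine ⟨isMinOn_univ_iff.2 hle, isMinOn_univ_iff.2 fun p => ?_⟩
    rw [InfConv.objR_eq_iInf_objU A f J hα, InfConv.objR_eq_iInf_objU A f J hα]
    -- `μ.polar` competes in the infimum at `(μ(S), |μ|)` and its value is the global minimum of
    -- (P'), which bounds every other such infimum from below.
    refine (iInf₂_le μ.polar ?_).trans (le_iInf₂ fun u _ => hle _)
    rw [← setIntegral_univ]
    exact (μ.isDensity_polar e _ .univ).symm
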